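/- Let $K$ be a field and let $H$ be a finite-dimensional Hopf algebra over $K$ with coproduct $\Delta$ and counit $\varepsilon$. Let $H=\bigoplus_{p\in\mathbb Z}A^p$ be a $\mathbb Z$-grading of the algebra $H$ (a direct sum of subspaces with $A^pA^q\subseteq A^{p+q}$) that is nontrivial ($A^p\neq 0$ for some $p\neq 0$), and suppose that $$\Delta(A^p)\subseteq\bigoplus_{q\in\mathbb Z}A^q\otimes A^{p-q}\qquad\text{for all }p\in\mathbb Z .$$ Let $H^*$ be the dual algebra, with product $(fg)(x)=\sum f(x_{(1)})g(x_{(2)})$ and unit $\varepsilon$. Let $D(H)$ be the Drinfeld double; as an algebra it is generated by $H$ and $H^*$ (with their own products and units), subject to the relations $$\sum f(\,\cdot\,x_{(1)})\;x_{(2)}=\sum x_{(1)}\;f(x_{(2)}\,\cdot\,)\qquad(x\in H,\ f\in H^*).$$ Then the canonical algebra maps $H\to D(H)$ and $H^*\to D(H)$ are injective; identify $H$ and $H^*$ with their images. For a basis $\{a_i\}$ of $H$ with dual basis $\{a_i^*\}$, the element $R=\sum_i a_i\otimes a_i^*\in D(H)\otimes D(H)$ does not depend on the basis. Choose $\{a_i\}$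 to be a union of bases of the subspaces $A^p$, and let $B^p\subseteq H^*$ be the span of those $a_i^*$ for which $a_i\in A^p$. Then: 1. $H=\bigoplus_pA^p$ and $H^*=\bigoplus_pB^p$ are $\mathbb Z$-gradings of these subalgebras of $D(H)$; in particular $B^pB^q\subseteq B^{p+q}$; 2. $R$ satisfies the constant Yang–Baxter equation $R_{12}R_{13}R_{23}=R_{23}R_{13}R_{12}$ in $D(H)\otimes D(H)\otimes D(H)$; 3. $R\in\bigoplus_pA^p\otimes B^p$; 4. both gradings are nontrivial, and $R\notin A^0\otimes B^0$. -/

import Mathlib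

open scoped TensorProduct

section Grading

variable {K D : Type*} [Field K] [Ring D] [Algebra K D]

/-- A `ℤ`-grading `S = ⨁ p, A p` of a subalgebra `S` of `D`: the sum of the subspaces `A p` is `S`,
the sum is direct, and `A p * A q ⊆ A (p + q)`. -/
structure IsZGrading (S : Subalgebra K D) (A : ℤ → Submodule K D) : Prop where
  iSup_eq : ⨆ p, A p = Subalgebra.toSubmodule S
  indep : iSupIndep A
  mul_mem : ∀ p q : ℤ, ∀ x ∈ A p, ∀ y ∈ A q, x * y ∈ A (p + q)

/-- The grading has a nonzero piece in a nonzero degree. -/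
def IsNontrivialGrading (A : ℤ → Submodule K D) : Prop :=
  ∃ p : ℤ, p ≠ 0 ∧ A p ≠ ⊥

/-- `U ⊗ V` as a subspace of `D ⊗ D`: the span of all `u ⊗ v` with `u ∈ U` and `v ∈ V`. -/
abbrev tensorPiece (U V : Submodule K D) : Submodule K (D ⊗[K] D) :=
  LinearMap.range (TensorProduct.mapIncl U V)

end Grading

section YangBaxter

variable (K D : Type*) [Field K] [Ring D] [Algebra K D]

/-- `a ⊗ b ↦ a ⊗ b ⊗ 1`. -/
noncomputable def leg12 : D ⊗[K] D →ₐ[K] (D ⊗[K] D) ⊗[K] D :=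
  Algebra.TensorProduct.includeLeft

/-- `a ⊗ b ↦ a ⊗ 1 ⊗ b`. -/
noncomputable def leg13 : D ⊗[K] D →ₐ[K] (D ⊗[K] D) ⊗[K] D :=
  Algebra.TensorProduct.map Algebra.TensorProduct.includeLeft (AlgHom.id K D)

/-- `a ⊗ b ↦ 1 ⊗ a ⊗ b`. -/
noncomputable def leg23 : D ⊗[K] D →ₐ[K] (D ⊗[K] D) ⊗[K] D :=
  Algebra.TensorProduct.map Algebra.TensorProduct.includeRight (AlgHom.id K D)

variable {K D}

/-- The constant Yang–Baxter equation `R₁₂ R₁₃ R₂₃ = R₂₃ R₁₃ R₁₂` in `D ⊗ D ⊗ D`. -/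
def IsYangBaxter (R : D ⊗[K] D) : Prop :=
  leg12 K D R * leg13 K D R * leg23 K D R = leg23 K D R * leg13 K D R * leg12 K D R

/-- The data to which the universal Baxterization `R ↦ R(μ) = ∑ μ ^ p R_p` applies: subalgebras
`S = ⨁ p, A p` and `T = ⨁ p, B p` of `D` with `ℤ`-gradings, and a solution `R` of the constant
Yang–Baxter equation which is a sum of terms `a ⊗ b` with `a ∈ A p`, `b ∈ B p` for some `p`. -/
structure IsBaxterizable (S T : Subalgebra K D) (A B : ℤ → Submodule K D) (R : D ⊗[K] D) :
    Prop where
  grading_left : IsZGrading S A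
  grading_right : IsZGrading T B
  yangBaxter : IsYangBaxter R
  mem : R ∈ ⨆ p, tensorPiece (A p) (B p)

end YangBaxter

section Double

variable (K H : Type*) [Field K] [Ring H] [HopfAlgebra K H]

/-- The algebra `H*` dual to `H`: linear forms on `H` with the convolution product
`(f * g) x = ∑ f x₍₁₎ * g x₍₂₎` and unit the counit `ε` (Mathlib's structure on `WithConv`). -/
abbrev HopfDual : Type _ := WithConv (H →ₗ[K] K)

variable {K H}

/-- The linear form `z ↦ f (z * y)`. For finite-dimensional `H`, where `H*` has the coproduct
`Δ f = ∑ f₍₁₎ ⊗ f₍₂₎` with `f (x * y) = ∑ f₍₁₎ x * f₍₂₎ y`, it is `∑ f₍₂₎ y • f₍₁₎`. -/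
noncomputable def HopfDual.evalRight (f : HopfDual K H) (y : H) : HopfDual K H :=
  WithConv.toConv (f.ofConv ∘ₗ LinearMap.mulRight K y)

/-- The linear form `z ↦ f (y * z)`, i.e. `∑ f₍₁₎ y • f₍₂₎`. -/
noncomputable def HopfDual.evalLeft (f : HopfDual K H) (y : H) : HopfDual K H :=
  WithConv.toConv (f.ofConv ∘ₗ LinearMap.mulLeft K y)

namespace DrinfeldDouble

variable (K) in
/-- The generator of the free algebra on the vector space `H × H*` given by `x : H`. -/
noncomputable def genL (x : H) : TensorAlgebra K (H × HopfDual K H) :=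
  TensorAlgebra.ι K (x, 0)

/-- The generator of the free algebra on the vector space `H × H*` given by `f : H*`. -/
noncomputable def genR (f : HopfDual K H) : TensorAlgebra K (H × HopfDual K H) :=
  TensorAlgebra.ι K (0, f)

/-- The defining relations of the Drinfeld double: the products and units of `H` and of `H*` are
kept, and elements of `H` and `H*` are interchanged by
`∑ f₍₂₎(x₍₁₎) f₍₁₎ x₍₂₎ = ∑ f₍₁₎(x₍₂₎) x₍₁₎ f₍₂₎`,
which for an invertible antipode `S` is the same as the straightening rule
`x f = ∑ f(S⁻¹(x₍₃₎) ? x₍₁₎) x₍₂₎`.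
The sums run over the terms `x₍₁₎ ⊗ x₍₂₎` of any expression of the coproduct of `x`. -/
inductive Rel : TensorAlgebra K (H × HopfDual K H) → TensorAlgebra K (H × HopfDual K H) → Prop
  | one_left : Rel (genL K 1) 1
  | mul_left (x y : H) : Rel (genL K x * genL K y) (genL K (x * y))
  | one_right : Rel (genR 1) 1
  | mul_right (f g : HopfDual K H) : Rel (genR f * genR g) (genR (f * g))
  | cross (f : HopfDual K H) (x : H) (r : Coalgebra.Repr K x (H × H)) :
      Rel (∑ i ∈ r.index, genR (f.evalRight (r.left i)) * genL K (r.right i))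
        (∑ i ∈ r.index, genL K (r.left i) * genR (f.evalLeft (r.right i)))

end DrinfeldDouble

variable (K H) in
/-- The underlying algebra of the Drinfeld double `D(H)`, generated by `H` and `H*` subject to the
relations above. -/
def DrinfeldDouble : Type _ := RingQuot (DrinfeldDouble.Rel (K := K) (H := H))

namespace DrinfeldDouble

noncomputable instance : Ring (DrinfeldDouble K H) :=
  inferInstanceAs (Ring (RingQuot (Rel (K := K) (H := H))))

noncomputable instance : Algebra K (DrinfeldDouble K H) :=
  inferInstanceAs (Algebra K (RingQuot (Rel (K := K) (H := H))))

variable (K H) in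
/-- The quotient map from the free algebra on `H × H*`. -/
noncomputable def proj : TensorAlgebra K (H × HopfDual K H) →ₐ[K] DrinfeldDouble K H :=
  RingQuot.mkAlgHom K (Rel (K := K) (H := H))

theorem proj_eq {a b : TensorAlgebra K (H × HopfDual K H)} (h : Rel a b) :
    proj K H a = proj K H b :=
  RingQuot.mkAlgHom_rel K h

variable (K H) in
/-- The canonical map `H → D(H)`, `x ↦ x ε`. -/
noncomputable def ofAlg : H →ₐ[K] DrinfeldDouble K H :=
  AlgHom.ofLinearMap
    ((proj K H).toLinearMap ∘ₗ TensorAlgebra.ι K ∘ₗ LinearMap.inl K H (HopfDual K H))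
    ((proj_eq Rel.one_left).trans (map_one _))
    (fun x y => ((proj_eq (Rel.mul_left x y)).symm.trans (map_mul _ _ _)))

variable (K H) in
/-- The canonical map `H* → D(H)`, `f ↦ 1 f`. -/
noncomputable def ofDual : HopfDual K H →ₐ[K] DrinfeldDouble K H :=
  AlgHom.ofLinearMap
    ((proj K H).toLinearMap ∘ₗ TensorAlgebra.ι K ∘ₗ LinearMap.inr K H (HopfDual K H))
    ((proj_eq Rel.one_right).trans (map_one _))
    (fun f g => ((proj_eq (Rel.mul_right f g)).symm.trans (map_mul _ _ _)))

/-- The canonical element `∑ i, aᵢ ⊗ aᵢ*` of `D(H) ⊗ D(H)` for a finite basis `a` of `H`. -/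
noncomputable def canonicalR {ι : Type*} [Fintype ι] (a : Module.Basis ι K H) :
    DrinfeldDouble K H ⊗[K] DrinfeldDouble K H :=
  ∑ i, ofAlg K H (a i) ⊗ₜ[K] ofDual K H (WithConv.toConv (a.coord i))

end DrinfeldDouble

/-- The subspace `B p` of `H*` spanned by those dual basis vectors `aᵢ*` for which the basis
vector `aᵢ` has degree `p`. -/
def dualPiece {ι : Type*} (a : Module.Basis ι K H) (deg : ι → ℤ) (p : ℤ) :
    Submodule K (HopfDual K H) :=
  Submodule.span K {f | ∃ i, deg i = p ∧ f = WithConv.toConv (a.coord i)}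

end Double

/-! ### Antipode identities and anticomultiplicativity of the antipode. -/

section Antipode

open Coalgebra HopfAlgebra WithConv TensorProduct

variable {K H : Type*} [Field K] [Ring H] [HopfAlgebra K H]

/-! The Yang–Baxter equation is formal. The product of H* is the transpose of Δ, so R₁₃R₂₃ = (Δ ⊗
id)R and R₂₃R₁₃ = (Δᵒᵖ ⊗ id)R (`sum_mul_coord`), while the cross relation amounts to RΔ(x) = Δᵒᵖ(x)R
(`canonicalR_mul_comul`). The grading of H* is formal too: the degree-p piece consists of the forms
vanishing in all other degrees, and a graded coproduct makes degrees add under convolution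
(`isZGrading_dualPiece`).

The substantial point is that H and H* embed in D(H), since a quotient by relations could collapse.
An explicit representation `rep` of D(H) in H ⊗ End H settles this: x and f can be read off from
their images. Its formula contains S⁻¹, so S must first be shown injective (`antipode_injective`).
For this, the form y ↦ Tr(L_y ∘ S² ∘ `rightHit f`) is a left integral on H
(`traceIntegral_leftHit`), it is nonzero for some f (`exists_traceIntegral_ne_zero`), and a nonzero
integral forces ker S = 0. -/

/-- `∑ x₍₁₎ S(x₍₂₎) ⊗ x₍₃₎ = 1 ⊗ x`. -/
theorem sum_mul_antipode_tmul {ι : Type*} {κ : ι → Type*} {x : H} (r : Repr K x ι)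
    (s : (i : ι) → Repr K (r.right i) (κ i)) :
    ∑ i ∈ r.index, ∑ j ∈ (s i).index,
      (r.left i * antipode K ((s i).left j)) ⊗ₜ[K] (s i).right j = 1 ⊗ₜ x := by
  have h := sum_tmul_tmul_eq r (fun i => ℛ K (r.left i)) s
  have h' := congr((TensorProduct.map (LinearMap.mul' K H) LinearMap.id ∘ₗ
    (TensorProduct.assoc K H H H).symm.toLinearMap ∘ₗ
    TensorProduct.map LinearMap.id (TensorProduct.map (antipode K) LinearMap.id)) $h)
  simp only [map_sum, LinearMap.comp_apply, TensorProduct.map_tmul, LinearMap.id_apply,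
    LinearEquiv.coe_coe, TensorProduct.assoc_symm_tmul, LinearMap.mul'_apply] at h'
  rw [← h']
  simp_rw [← TensorProduct.sum_tmul, sum_mul_antipode_eq_smul, TensorProduct.smul_tmul,
    ← TensorProduct.tmul_sum, sum_counit_smul]

/-- `∑ x₍₁₎ ⊗ x₍₂₎ S(x₍₃₎) = x ⊗ 1`. -/
theorem sum_tmul_mul_antipode {ι : Type*} {κ : ι → Type*} {x : H} (r : Repr K x ι)
    (s : (i : ι) → Repr K (r.left i) (κ i)) :
    ∑ i ∈ r.index, ∑ j ∈ (s i).index,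
      (s i).left j ⊗ₜ[K] ((s i).right j * antipode K (r.right i)) = x ⊗ₜ 1 := by
  have h := sum_tmul_tmul_eq r s (fun i => ℛ K (r.right i))
  have h' := congr((TensorProduct.map LinearMap.id (LinearMap.mul' K H) ∘ₗ
    TensorProduct.map LinearMap.id (TensorProduct.map LinearMap.id (antipode K))) $h)
  simp only [map_sum, LinearMap.comp_apply, TensorProduct.map_tmul, LinearMap.id_apply,
    LinearMap.mul'_apply] at h'
  rw [h']
  simp_rw [← TensorProduct.tmul_sum, sum_mul_antipode_eq_smul, ← TensorProduct.smul_tmul,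
    ← TensorProduct.sum_tmul]
  congr 1
  have := congr(TensorProduct.rid K H $(sum_tmul_counit_eq r))
  simpa only [map_sum, TensorProduct.rid_tmul, one_smul] using this

/-- `∑ x₍₁₎ ⊗ S(x₍₂₎) x₍₃₎ = x ⊗ 1`. -/
theorem sum_tmul_antipode_mul {ι : Type*} {κ : ι → Type*} {x : H} (r : Repr K x ι)
    (s : (i : ι) → Repr K (r.left i) (κ i)) :
    ∑ i ∈ r.index, ∑ j ∈ (s i).index,
      (s i).left j ⊗ₜ[K] (antipode K ((s i).right j) * r.right i) = x ⊗ₜ 1 := by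
  have h := sum_tmul_tmul_eq r s (fun i => ℛ K (r.right i))
  have h' := congr((TensorProduct.map LinearMap.id (LinearMap.mul' K H) ∘ₗ
    TensorProduct.map LinearMap.id (TensorProduct.map (antipode K) LinearMap.id)) $h)
  simp only [map_sum, LinearMap.comp_apply, TensorProduct.map_tmul, LinearMap.id_apply,
    LinearMap.mul'_apply] at h'
  rw [h']
  simp_rw [← TensorProduct.tmul_sum, sum_antipode_mul_eq_smul, ← TensorProduct.smul_tmul,
    ← TensorProduct.sum_tmul]
  congr 1
  have := congr(TensorProduct.rid K H $(sum_tmul_counit_eq r))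
  simpa only [map_sum, TensorProduct.rid_tmul, one_smul] using this

/-- The antipode of a Hopf algebra composed with an algebra map is a convolution inverse of it. -/
theorem AlgHom.convMul_comp_antipode {B : Type*} [Ring B] [Algebra K B] (h : H →ₐ[K] B) :
    toConv h.toLinearMap * toConv (h.toLinearMap ∘ₗ antipode K) = 1 := by
  have := LinearMap.algHom_comp_convMul_distrib h (toConv (LinearMap.id (R := K) (M := H)))
    (toConv (antipode K))
  rw [LinearMap.id_mul_antipode] at this
  apply WithConv.ofConv_injective
  refine Eq.trans this.symm ?_
  ext x
  simp

theorem AlgHom.comp_antipode_convMul {B : Type*} [Ring B] [Algebra K B] (h : H →ₐ[K] B) :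
    toConv (h.toLinearMap ∘ₗ antipode K) * toConv h.toLinearMap = 1 := by
  have := LinearMap.algHom_comp_convMul_distrib h (toConv (antipode K))
    (toConv (LinearMap.id (R := K) (M := H)))
  rw [LinearMap.antipode_mul_id] at this
  apply WithConv.ofConv_injective
  refine Eq.trans this.symm ?_
  ext x
  simp

/-- The antipode reverses the comultiplication. -/
theorem comul_comp_antipode :
    (comul ∘ₗ antipode K : H →ₗ[K] H ⊗[K] H) =
      TensorProduct.map (antipode K) (antipode K) ∘ₗ
        (TensorProduct.comm K H H).toLinearMap ∘ₗ comul := by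
  apply WithConv.toConv_injective
  -- In the convolution algebra Hom(H, H ⊗ H) one has Δ = i₁ * i₂. Then Δ ∘ S is a left inverse of
  -- Δ, and (i₂ ∘ S) * (i₁ ∘ S), which is the right-hand side, is a right inverse; so they agree.
  let i₁ : H →ₐ[K] H ⊗[K] H := Algebra.TensorProduct.includeLeft
  let i₂ : H →ₐ[K] H ⊗[K] H := Algebra.TensorProduct.includeRight
  have hδ : toConv (comul : H →ₗ[K] H ⊗[K] H) =
      toConv i₁.toLinearMap * toConv i₂.toLinearMap := by
    ext x
    rw [(ℛ K x).convMul_apply]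
    simp [i₁, i₂, (ℛ K x).eq]
  have hG : toConv (TensorProduct.map (antipode K) (antipode K) ∘ₗ
        (TensorProduct.comm K H H).toLinearMap ∘ₗ comul) =
      toConv (i₂.toLinearMap ∘ₗ antipode K) * toConv (i₁.toLinearMap ∘ₗ antipode K) := by
    ext x
    rw [(ℛ K x).convMul_apply]
    simp [i₁, i₂, ← (ℛ K x).eq]
  have key : toConv (comul : H →ₗ[K] H ⊗[K] H) *
      toConv (TensorProduct.map (antipode K) (antipode K) ∘ₗ
        (TensorProduct.comm K H H).toLinearMap ∘ₗ comul) = 1 := by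
    rw [hδ, hG, mul_assoc, ← mul_assoc (toConv i₂.toLinearMap), AlgHom.convMul_comp_antipode,
      one_mul, AlgHom.convMul_comp_antipode]
  exact left_inv_eq_right_inv
    (AlgHom.comp_antipode_convMul (Bialgebra.comulAlgHom K H)) key

/-- The Sweedler expression of the coproduct of `S x`. -/
noncomputable def Coalgebra.Repr.antipode {ι : Type*} {x : H} (r : Repr K x ι) :
    Repr K (HopfAlgebra.antipode K x) ι where
  index := r.index
  left i := HopfAlgebra.antipode K (r.right i)
  right i := HopfAlgebra.antipode K (r.left i)
  eq := by
    have := LinearMap.congr_fun (comul_comp_antipode (K := K) (H := H)) x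
    simp only [LinearMap.comp_apply, ← r.eq] at this
    simp [this]

end Antipode

/-! ### Trace integrals and injectivity of the antipode. -/

section Bijective

open Coalgebra HopfAlgebra WithConv TensorProduct

theorem Module.Basis.sum_coord_smul_map {K V W ι : Type*} [Semiring K] [AddCommMonoid V]
    [Module K V] [AddCommMonoid W] [Module K W] [Fintype ι] (a : Module.Basis ι K V)
    (φ : V →ₗ[K] W) (v : V) : ∑ j, a.coord j v • φ (a j) = φ v := by
  conv_rhs => rw [← a.sum_repr v, map_sum]
  simp

section Coalgebra

variable {K C : Type*} [CommSemiring K] [AddCommMonoid C] [Module K C] [Coalgebra K C]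

/-- The map `x ↦ ∑ f(x₍₂₎) x₍₁₎`. -/
noncomputable def rightHit (f : C →ₗ[K] K) : C →ₗ[K] C :=
  (TensorProduct.rid K C).toLinearMap ∘ₗ f.lTensor C ∘ₗ comul

/-- The map `x ↦ ∑ f(x₍₁₎) x₍₂₎`. -/
noncomputable def leftHit (f : C →ₗ[K] K) : C →ₗ[K] C :=
  (TensorProduct.lid K C).toLinearMap ∘ₗ f.rTensor C ∘ₗ comul

theorem rightHit_apply (f : C →ₗ[K] K) {ι : Type*} {x : C} (r : Repr K x ι) :
    rightHit f x = ∑ i ∈ r.index, f (r.right i) • r.left i := by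
  simp [rightHit, ← r.eq]

theorem leftHit_apply (f : C →ₗ[K] K) {ι : Type*} {x : C} (r : Repr K x ι) :
    leftHit f x = ∑ i ∈ r.index, f (r.left i) • r.right i := by
  simp [leftHit, ← r.eq]

theorem comul_rightHit (f : C →ₗ[K] K) {ι : Type*} {x : C} (r : Repr K x ι) :
    comul (rightHit f x) = ∑ i ∈ r.index, r.left i ⊗ₜ[K] rightHit f (r.right i) := by
  have h := sum_tmul_tmul_eq r (fun i => ℛ K (r.left i)) (fun i => ℛ K (r.right i))
  have h' := congr(TensorProduct.map LinearMap.id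
    ((TensorProduct.rid K C).toLinearMap ∘ₗ f.lTensor C) $h)
  simp only [map_sum, TensorProduct.map_tmul, LinearMap.id_apply, LinearMap.comp_apply,
    LinearMap.lTensor_tmul, LinearEquiv.coe_coe, TensorProduct.rid_tmul] at h'
  rw [rightHit_apply f r, map_sum]
  simp_rw [map_smul, rightHit_apply f (ℛ K (r.right _)), TensorProduct.tmul_sum]
  rw [← h']
  refine Finset.sum_congr rfl fun i _ => ?_
  rw [← (ℛ K (r.left i)).eq, Finset.smul_sum]
  simp_rw [TensorProduct.tmul_smul]

end Coalgebra

variable {K H : Type*} [Field K] [Ring H] [HopfAlgebra K H]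

theorem leftHit_mul (g : H →ₗ[K] K) {ι κ : Type*} {x y : H} (r : Repr K x ι) (s : Repr K y κ) :
    leftHit g (x * y) = ∑ i ∈ r.index, ∑ j ∈ s.index,
      g (r.left i * s.left j) • (r.right i * s.right j) := by
  simp [leftHit, Bialgebra.comul_mul, ← r.eq, ← s.eq, Finset.sum_mul_sum]

/-- `L_{g ⇀ y} ∘ Q = ∑ⱼ (aⱼ* ⇀) ∘ L_y ∘ Q ∘ (g(aⱼ S(·)) ⇀)` for `Q x = ∑ f(x₍₂₎) S²(x₍₁₎)`. -/
theorem mulLeft_leftHit_comp {ι : Type*} [Fintype ι] (a : Module.Basis ι K H)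
    (f g : H →ₗ[K] K) (y : H) :
    LinearMap.mulLeft K (leftHit g y) ∘ₗ (antipode K ∘ₗ antipode K ∘ₗ rightHit f) =
      ∑ j, leftHit (a.coord j) ∘ₗ ((LinearMap.mulLeft K y ∘ₗ
        (antipode K ∘ₗ antipode K ∘ₗ rightHit f)) ∘ₗ
          leftHit (g ∘ₗ LinearMap.mulLeft K (a j) ∘ₗ antipode K)) := by
  ext v
  let r := ℛ K v
  let s := fun i => ℛ K (r.right i)
  let t := ℛ K y
  let Q : H →ₗ[K] H := antipode K ∘ₗ antipode K ∘ₗ rightHit f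
  -- S² preserves the order of the coproduct, so Δ(Q x) = ∑ S²(x₍₁₎) ⊗ Q(x₍₂₎).
  have hQ : ∀ (g' : H →ₗ[K] K) i, leftHit g' (y * Q (r.right i)) =
      ∑ k ∈ t.index, ∑ j ∈ (s i).index, g' (t.left k * antipode K (antipode K ((s i).left j))) •
        (t.right k * Q ((s i).right j)) := fun g' i =>
    leftHit_mul g' t (Repr.antipode (Repr.antipode
        { index := (s i).index, left := (s i).left,
          right := fun j => rightHit f ((s i).right j),
          eq := (comul_rightHit f (s i)).symm }))
  -- Since S²(v₍₂₎) S(v₍₁₎) = S(v₍₁₎ S(v₍₂₎)), the extra factors inserted in the argument of g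
  -- collapse to 1.
  have key : ∀ k, ∑ i ∈ r.index, ∑ j ∈ (s i).index,
      g (t.left k * (antipode K (antipode K ((s i).left j)) * antipode K (r.left i))) •
        (t.right k * Q ((s i).right j)) = g (t.left k) • (t.right k * Q v) := fun k => by
    have := congr((TensorProduct.lid K H).toLinearMap (TensorProduct.map
      (g ∘ₗ LinearMap.mulLeft K (t.left k) ∘ₗ antipode K)
      (LinearMap.mulLeft K (t.right k) ∘ₗ Q) $(sum_mul_antipode_tmul r s)))
    simpa [antipode_mul_antidistrib] using this
  have hsum : ∀ w u : H, ∑ j, a.coord j w * g (a j * u) = g (w * u) := fun w u =>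
    a.sum_coord_smul_map (g ∘ₗ LinearMap.mulRight K u) w
  simp only [LinearMap.comp_apply, LinearMap.sum_apply, LinearMap.mulLeft_apply]
  change leftHit g y * Q v = ∑ j, leftHit (a.coord j) (y * Q _)
  simp_rw [leftHit_apply _ r, map_sum, Finset.mul_sum, map_sum, map_smul, mul_smul_comm, map_smul,
    hQ, leftHit_apply g t, Finset.sum_mul, smul_mul_assoc, ← key]
  simp_rw [Finset.smul_sum, smul_smul]
  rw [Finset.sum_comm]
  conv_rhs => rw [Finset.sum_comm]
  refine Finset.sum_congr rfl fun i _ => ?_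
  conv_rhs => rw [Finset.sum_comm]
  refine Finset.sum_congr rfl fun k _ => ?_
  conv_rhs => rw [Finset.sum_comm]
  refine Finset.sum_congr rfl fun j _ => ?_
  rw [← Finset.sum_smul]
  congr 1
  rw [← mul_assoc, ← hsum]
  exact Finset.sum_congr rfl fun _ _ => mul_comm _ _

/-- The basis sum merges the two hits into ∑ g(v₍₁₎ S(v₍₂₎)) v₍₃₎. The composites here are the outer
factors of `mulLeft_leftHit_comp` in reverse order, as they meet after a cyclic rotation under the
trace. -/
theorem sum_leftHit_comp_leftHit {ι : Type*} [Fintype ι] (a : Module.Basis ι K H)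
    (g : H →ₗ[K] K) :
    ∑ j, leftHit (g ∘ₗ LinearMap.mulLeft K (a j) ∘ₗ antipode K) ∘ₗ leftHit (a.coord j) =
      g 1 • LinearMap.id := by
  ext v
  let r := ℛ K v
  let s := fun i => ℛ K (r.right i)
  have hsum : ∀ w u : H, ∑ j, a.coord j w * g (a j * u) = g (w * u) := fun w u =>
    a.sum_coord_smul_map (g ∘ₗ LinearMap.mulRight K u) w
  have key := congr((TensorProduct.lid K H).toLinearMap (TensorProduct.map
      g LinearMap.id $(sum_mul_antipode_tmul r s)))
  simp only [map_sum, TensorProduct.map_tmul, LinearEquiv.coe_coe, TensorProduct.lid_tmul,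
    LinearMap.id_apply] at key
  simp only [LinearMap.sum_apply, LinearMap.comp_apply, LinearMap.smul_apply, LinearMap.id_apply]
  simp_rw [leftHit_apply _ r, map_sum, map_smul, leftHit_apply _ (s _)]
  rw [← key, Finset.sum_comm]
  refine Finset.sum_congr rfl fun i _ => ?_
  simp_rw [Finset.smul_sum, smul_smul]
  rw [Finset.sum_comm]
  refine Finset.sum_congr rfl fun j _ => ?_
  rw [← Finset.sum_smul]
  congr 1
  exact hsum _ _

/-- The linear form `y ↦ Tr(x ↦ ∑ f(x₍₂₎) y S²(x₍₁₎))`. -/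
noncomputable def traceIntegral (f : H →ₗ[K] K) : H →ₗ[K] K :=
  LinearMap.trace K H ∘ₗ
    LinearMap.lcomp K H (antipode K ∘ₗ antipode K ∘ₗ rightHit f) ∘ₗ LinearMap.mul K H

theorem traceIntegral_apply (f : H →ₗ[K] K) (y : H) :
    traceIntegral f y = LinearMap.trace K H
      (LinearMap.mulLeft K y ∘ₗ (antipode K ∘ₗ antipode K ∘ₗ rightHit f)) := rfl

variable [FiniteDimensional K H]

/-- This is the left integral property g * λ = g(1) λ in H*. Writing the operator as ∑ Aⱼ B Cⱼ by
`mulLeft_leftHit_comp`, cyclicity of the trace leaves B composed with ∑ Cⱼ Aⱼ = g(1) id. -/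
theorem traceIntegral_leftHit (f g : H →ₗ[K] K) (y : H) :
    traceIntegral f (leftHit g y) = g 1 * traceIntegral f y := by
  let a := Module.finBasis K H
  rw [traceIntegral_apply, mulLeft_leftHit_comp a, map_sum]
  have hcycle : ∀ A B C : H →ₗ[K] H, LinearMap.trace K H (A ∘ₗ B ∘ₗ C) =
      (LinearMap.trace K H ∘ₗ LinearMap.llcomp K H H H B) (C ∘ₗ A) := fun A B C => by
    rw [LinearMap.trace_comp_comm', LinearMap.comp_assoc]
    rfl
  simp_rw [hcycle]
  rw [← map_sum, sum_leftHit_comp_leftHit, map_smul]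
  rfl

/-- Summing the integrals of aᵢ* at S(aᵢ) gives the trace of v ↦ ∑ S(v₍₂₎) S²(v₍₁₎) = S(∑ S(v₍₁₎)
v₍₂₎) = ε(v) 1, a rank-one map of trace ε(1) = 1. -/
theorem exists_traceIntegral_ne_zero : ∃ f : H →ₗ[K] K, traceIntegral f ≠ 0 := by
  by_contra! h
  let a := Module.finBasis K H
  have h0 : ∑ i, traceIntegral (a.coord i) (antipode K (a i)) = 0 := by simp [h]
  simp_rw [traceIntegral_apply] at h0
  rw [← map_sum] at h0
  have h1 : ∑ i, LinearMap.mulLeft K (antipode K (a i)) ∘ₗ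
      (antipode K ∘ₗ antipode K ∘ₗ rightHit (a.coord i)) =
      (counit : H →ₗ[K] K).smulRight (1 : H) := by
    ext v
    let r := ℛ K v
    have hsum : ∀ w u : H, ∑ j, a.coord j w • (antipode K (a j) * u) = antipode K w * u :=
      fun w u => a.sum_coord_smul_map (LinearMap.mulRight K u ∘ₗ antipode K) w
    simp only [LinearMap.sum_apply, LinearMap.comp_apply, LinearMap.mulLeft_apply,
      LinearMap.smulRight_apply]
    simp_rw [rightHit_apply _ r, map_sum, map_smul, Finset.mul_sum, mul_smul_comm]
    rw [Finset.sum_comm]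
    simp_rw [hsum, ← antipode_mul_antidistrib]
    rw [← map_sum, sum_antipode_mul_eq_smul, map_smul, antipode_one]
  rw [h1, LinearMap.trace_smulRight] at h0
  simp at h0

/-- The antipode of a finite-dimensional Hopf algebra is injective (Larson–Sweedler). -/
theorem antipode_injective : Function.Injective (antipode K : H →ₗ[K] H) := by
  obtain ⟨f, hf⟩ := exists_traceIntegral_ne_zero (K := K) (H := H)
  obtain ⟨y₀, hy₀⟩ : ∃ y, traceIntegral f y ≠ 0 := by
    by_contra! h
    exact hf (LinearMap.ext h)
  rw [injective_iff_map_eq_zero]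
  intro h hh
  let r := ℛ K h
  let s := fun i => ℛ K (r.right i)
  let s' := fun i => ℛ K (r.left i)
  -- With λ the integral, its invariance turns the sum into ∑ g(y₍₁₎ S(h₍₂₎) h₍₃₎) λ(y₍₂₎ S(h₍₁₎)) =
  -- ∑ g(y₍₁₎) λ(y₍₂₎ S(h)), which vanishes because S(h) = 0.
  have hz : ∀ (y : H) (g : H →ₗ[K] K),
      ∑ i ∈ r.index, traceIntegral f (y * antipode K (r.left i)) * g (r.right i) = 0 := by
    intro y g
    let t := ℛ K y
    have h1 : ∀ i, traceIntegral f (y * antipode K (r.left i)) * g (r.right i) =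
        ∑ k ∈ t.index, ∑ j ∈ (s' i).index,
          g (t.left k * (antipode K ((s' i).right j) * r.right i)) *
            traceIntegral f (t.right k * antipode K ((s' i).left j)) := by
      intro i
      have := traceIntegral_leftHit f (g ∘ₗ LinearMap.mulRight K (r.right i))
        (y * antipode K (r.left i))
      rw [leftHit_mul _ t (s' i).antipode] at this
      simp only [LinearMap.comp_apply, LinearMap.mulRight_apply, one_mul] at this
      rw [mul_comm, ← this]
      simp [Repr.antipode, mul_assoc]
    have key : ∀ k, ∑ i ∈ r.index, ∑ j ∈ (s' i).index,
        g (t.left k * (antipode K ((s' i).right j) * r.right i)) *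
            traceIntegral f (t.right k * antipode K ((s' i).left j)) = 0 := fun k => by
      have := congr((TensorProduct.lid K K).toLinearMap (TensorProduct.map
        (traceIntegral f ∘ₗ LinearMap.mulLeft K (t.right k) ∘ₗ antipode K)
        (g ∘ₗ LinearMap.mulLeft K (t.left k)) $(sum_tmul_antipode_mul r s')))
      simpa [hh, mul_comm] using this
    simp_rw [h1]
    rw [Finset.sum_comm]
    exact Finset.sum_eq_zero fun k _ => key k
  let a := Module.finBasis K H
  refine (Module.forall_dual_apply_eq_zero_iff K h).mp fun g => ?_
  -- Applying S inside λ(y₀ ·) to h₍₁₎ S(h₍₂₎) gives λ(y₀) g(h) = ∑ λ(y₀ S²(h₍₂₎) S(h₍₁₎)) g(h₍₃₎).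
  -- Expanding h₍₂₎ in the basis makes this a sum of instances of `hz` with y = y₀ S²(aₖ).
  have key := congr((TensorProduct.lid K K).toLinearMap (TensorProduct.map
    (traceIntegral f ∘ₗ LinearMap.mulLeft K y₀ ∘ₗ antipode K) g $(sum_mul_antipode_tmul r s)))
  simp only [map_sum, TensorProduct.map_tmul, LinearMap.comp_apply, LinearMap.mulLeft_apply,
    LinearEquiv.coe_coe, TensorProduct.lid_tmul, antipode_one, mul_one,
    antipode_mul_antidistrib, smul_eq_mul] at key
  refine (mul_eq_zero.mp (key.symm.trans ?_)).resolve_left hy₀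
  have hsum : ∀ w u : H, ∑ j, a.coord j w * traceIntegral f (y₀ * (antipode K (antipode K (a j)) * u))
      = traceIntegral f (y₀ * (antipode K (antipode K w) * u)) := fun w u =>
    a.sum_coord_smul_map (traceIntegral f ∘ₗ LinearMap.mulLeft K y₀ ∘ₗ LinearMap.mulRight K u ∘ₗ
      antipode K ∘ₗ antipode K) w
  have hz' : ∑ k, ∑ i ∈ r.index, traceIntegral f (y₀ * antipode K (antipode K (a k)) *
      antipode K (r.left i)) * (g ∘ₗ leftHit (a.coord k)) (r.right i) = 0 :=
    Finset.sum_eq_zero fun k _ => hz _ _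
  rw [← hz', Finset.sum_comm]
  refine Finset.sum_congr rfl fun i _ => ?_
  simp_rw [LinearMap.comp_apply, leftHit_apply _ (s i), map_sum, Finset.mul_sum]
  rw [Finset.sum_comm]
  refine Finset.sum_congr rfl fun j _ => ?_
  rw [← hsum, Finset.sum_mul]
  refine Finset.sum_congr rfl fun k _ => ?_
  simp only [map_smul, smul_eq_mul, mul_assoc]
  ring

end Bijective

/-! ### A representation of the double that separates elements of H and of H*. -/

section Faithful

open Coalgebra HopfAlgebra WithConv TensorProduct

section Bialgebra

variable {K H : Type*} [Field K] [Ring H] [HopfAlgebra K H]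

theorem rightHit_counit : rightHit (counit : H →ₗ[K] K) = LinearMap.id := by
  ext x
  simp [rightHit]

theorem rightHit_convMul (f g : HopfDual K H) :
    rightHit (f * g).ofConv = rightHit f.ofConv ∘ₗ rightHit g.ofConv := by
  ext x
  let r := ℛ K x
  let s := fun i => ℛ K (r.left i)
  let t := fun i => ℛ K (r.right i)
  have h := congr((TensorProduct.rid K H).toLinearMap (TensorProduct.map LinearMap.id
    (LinearMap.mul' K K ∘ₗ TensorProduct.map f.ofConv g.ofConv) $(sum_tmul_tmul_eq r s t)))
  simp only [map_sum, TensorProduct.map_tmul, LinearMap.id_apply, LinearMap.comp_apply,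
    LinearMap.mul'_apply, LinearEquiv.coe_coe, TensorProduct.rid_tmul] at h
  rw [LinearMap.comp_apply, rightHit_apply _ r, rightHit_apply _ r]
  simp_rw [map_sum, map_smul, rightHit_apply _ (s _), Finset.smul_sum, smul_smul]
  simp_rw [mul_comm (g.ofConv _)]
  rw [h]
  refine Finset.sum_congr rfl fun i _ => ?_
  rw [← Finset.sum_smul]
  exact congr($((t i).convMul_apply f g) • r.left i)

theorem rightHit_mul (f : H →ₗ[K] K) {ι κ : Type*} {x y : H} (r : Repr K x ι) (s : Repr K y κ) :
    rightHit f (x * y) = ∑ i ∈ r.index, ∑ j ∈ s.index,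
      f (r.right i * s.right j) • (r.left i * s.left j) := by
  simp [rightHit, Bialgebra.comul_mul, ← r.eq, ← s.eq, Finset.sum_mul_sum]

variable (K H) in
/-- The algebra `H ⊗ End H`, in which the Drinfeld double of `H` is represented. -/
abbrev RepTarget : Type _ := H ⊗[K] Module.End K H

variable (K H) in
/-- The action `f ↦ (x ↦ ∑ f(x₍₂₎) x₍₁₎)` of the dual algebra on `H`. -/
noncomputable def rightHitHom : HopfDual K H →ₐ[K] Module.End K H :=
  AlgHom.ofLinearMap
    { toFun := fun f => rightHit f.ofConv
      map_add' := fun f g => by ext x; simp [rightHit, LinearMap.lTensor_add]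
      map_smul' := fun c f => by ext x; simp [rightHit, LinearMap.lTensor_smul] }
    (by
      have : (1 : HopfDual K H).ofConv = counit := by ext; rfl
      simp [this, rightHit_counit]; rfl)
    rightHit_convMul

theorem rightHitHom_apply (f : HopfDual K H) : rightHitHom K H f = rightHit f.ofConv := rfl

variable (K H) in
/-- The representation `f ↦ 1 ⊗ (x ↦ ∑ f(x₍₂₎) x₍₁₎)` of the dual algebra. -/
noncomputable def dualRep : HopfDual K H →ₐ[K] RepTarget K H :=
  Algebra.TensorProduct.includeRight.comp (rightHitHom K H)

theorem dualRep_apply (f : HopfDual K H) : dualRep K H f = 1 ⊗ₜ rightHitHom K H f := rfl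

/-- `HopfDual.evalLeft f` as a linear map. -/
noncomputable def HopfDual.evalLeftₗ (f : HopfDual K H) : H →ₗ[K] HopfDual K H where
  toFun := f.evalLeft
  map_add' x y := by ext; simp [HopfDual.evalLeft, add_mul]
  map_smul' c x := by ext; simp [HopfDual.evalLeft]

/-- `HopfDual.evalRight f` as a linear map. -/
noncomputable def HopfDual.evalRightₗ (f : HopfDual K H) : H →ₗ[K] HopfDual K H where
  toFun := f.evalRight
  map_add' x y := by ext; simp [HopfDual.evalRight, mul_add]
  map_smul' c x := by ext; simp [HopfDual.evalRight]

theorem HopfDual.evalLeftₗ_apply (f : HopfDual K H) (x : H) : f.evalLeftₗ x = f.evalLeft x := rfl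

theorem HopfDual.evalRightₗ_apply (f : HopfDual K H) (x : H) :
    f.evalRightₗ x = f.evalRight x := rfl

variable (K H) in
/-- The algebra map `x ↦ ∑ x₍₁₎ ⊗ L_{x₍₂₎}`. -/
noncomputable def leftRep : H →ₐ[K] RepTarget K H :=
  (Algebra.TensorProduct.map (AlgHom.id K H) (Algebra.lmul K H)).comp (Bialgebra.comulAlgHom K H)

theorem leftRep_apply {ι : Type*} {x : H} (r : Repr K x ι) :
    leftRep K H x = ∑ i ∈ r.index, r.left i ⊗ₜ LinearMap.mulLeft K (r.right i) := by
  simp [leftRep, ← r.eq]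
  rfl

/-- On the End H factor this is f ⇀ (x z) = ∑ x₍₁₎ (f(x₍₂₎ ·) ⇀ z), from multiplicativity of Δ. It
is the half of the cross relation that involves `evalLeft`. -/
theorem dualRep_mul_leftRep (f : HopfDual K H) {ι : Type*} {x : H} (r : Repr K x ι) :
    dualRep K H f * leftRep K H x =
      ∑ i ∈ r.index, leftRep K H (r.left i) * dualRep K H (f.evalLeft (r.right i)) := by
  let s := fun i => ℛ K (r.left i)
  let t := fun i => ℛ K (r.right i)
  have h := congr((TensorProduct.map LinearMap.id
    (LinearMap.mul' K (Module.End K H) ∘ₗ TensorProduct.map (LinearMap.mul K H)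
      ((rightHitHom K H).toLinearMap ∘ₗ f.evalLeftₗ)) $(sum_tmul_tmul_eq r s t)))
  simp only [map_sum, TensorProduct.map_tmul, LinearMap.id_apply, LinearMap.comp_apply,
    LinearMap.mul'_apply, HopfDual.evalLeftₗ_apply, AlgHom.toLinearMap_apply] at h
  rw [leftRep_apply r, Finset.mul_sum]
  simp_rw [leftRep_apply (s _), dualRep_apply, Finset.sum_mul,
    Algebra.TensorProduct.tmul_mul_tmul, one_mul, mul_one]
  refine Eq.trans ?_ h.symm
  refine Finset.sum_congr rfl fun i _ => ?_
  rw [← TensorProduct.tmul_sum]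
  congr 1
  ext z
  simp only [LinearMap.sum_apply, Module.End.mul_apply, LinearMap.mulLeft_apply,
    LinearMap.mul_apply_apply, rightHitHom_apply]
  rw [rightHit_mul _ (t i) (ℛ K z)]
  refine Finset.sum_congr rfl fun j _ => ?_
  rw [rightHit_apply _ (ℛ K z), Finset.mul_sum]
  simp_rw [mul_smul_comm]
  rfl

end Bialgebra

variable {K H : Type*} [Field K] [Ring H] [HopfAlgebra K H] [FiniteDimensional K H]

variable (K H) in
/-- The antipode of a finite-dimensional Hopf algebra as a linear equivalence. -/
noncomputable def antipodeEquiv : H ≃ₗ[K] H :=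
  LinearEquiv.ofInjectiveEndo (antipode K) antipode_injective

theorem antipodeEquiv_apply (x : H) : antipodeEquiv K H x = antipode K x := rfl

theorem antipodeEquiv_symm_one : (antipodeEquiv K H).symm 1 = 1 := by
  rw [LinearEquiv.symm_apply_eq, antipodeEquiv_apply, antipode_one]

theorem antipodeEquiv_symm_mul (x y : H) : (antipodeEquiv K H).symm (x * y) =
    (antipodeEquiv K H).symm y * (antipodeEquiv K H).symm x := by
  rw [LinearEquiv.symm_apply_eq, antipodeEquiv_apply, antipode_mul_antidistrib,
    ← antipodeEquiv_apply, ← antipodeEquiv_apply, LinearEquiv.apply_symm_apply,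
    LinearEquiv.apply_symm_apply]

theorem counit_antipodeEquiv_symm (x : H) :
    counit (R := K) ((antipodeEquiv K H).symm x) = counit (R := K) x := by
  conv_rhs => rw [← (antipodeEquiv K H).apply_symm_apply x, antipodeEquiv_apply, counit_antipode]

variable (K H) in
/-- The algebra map `x ↦ 1 ⊗ R_{S⁻¹ x}`. -/
noncomputable def rightRep : H →ₐ[K] RepTarget K H :=
  Algebra.TensorProduct.includeRight.comp <| AlgHom.ofLinearMap
    ((LinearMap.mul K H).flip ∘ₗ (antipodeEquiv K H).symm.toLinearMap)
    (by ext; simp [antipodeEquiv_symm_one])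
    (fun x y => by ext; simp [antipodeEquiv_symm_mul, mul_assoc])

theorem rightRep_apply (x : H) :
    rightRep K H x = 1 ⊗ₜ LinearMap.mulRight K ((antipodeEquiv K H).symm x) := rfl

theorem commute_rightRep_leftRep (x y : H) : Commute (rightRep K H x) (leftRep K H y) := by
  rw [rightRep_apply, leftRep_apply (ℛ K y)]
  refine Commute.sum_right _ _ _ fun i _ => ?_
  simp only [Commute, SemiconjBy, Algebra.TensorProduct.tmul_mul_tmul, one_mul, mul_one]
  congr 1
  ext z
  simp [mul_assoc]

variable (K H) in
/-- The representation `x ↦ ∑ x₍₂₎ ⊗ L_{x₍₃₎} R_{S⁻¹ x₍₁₎}` of `H`. -/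
noncomputable def algRep : H →ₐ[K] RepTarget K H :=
  (Algebra.TensorProduct.lift (rightRep K H) (leftRep K H) commute_rightRep_leftRep).comp
    (Bialgebra.comulAlgHom K H)

theorem algRep_apply {ι : Type*} {x : H} (r : Repr K x ι) :
    algRep K H x = ∑ i ∈ r.index, rightRep K H (r.left i) * leftRep K H (r.right i) := by
  simp [algRep, ← r.eq]

/-- The `evalRight` half of the cross relation. For x = S(z), the left side sends v to ∑ f(v₍₂₎ z₍₂₎
S(z₍₃₎)) v₍₁₎ z₍₁₎ = ∑ f(v₍₂₎) v₍₁₎ z. -/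
theorem sum_dualRep_mul_rightRep (f : HopfDual K H) {ι : Type*} {x : H} (r : Repr K x ι) :
    ∑ i ∈ r.index, dualRep K H (f.evalRight (r.left i)) * rightRep K H (r.right i) =
      rightRep K H x * dualRep K H f := by
  obtain ⟨z, rfl⟩ := (antipodeEquiv K H).surjective x
  let q := ℛ K z
  have hswap : ∑ i ∈ r.index, dualRep K H (f.evalRight (r.left i)) * rightRep K H (r.right i) =
      ∑ i ∈ q.index, dualRep K H (f.evalRight (q.antipode.left i)) *
        rightRep K H (q.antipode.right i) := by
    change _ = ∑ i ∈ q.antipode.index, _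
    have h := congr((LinearMap.mul' K (RepTarget K H) ∘ₗ
      TensorProduct.map ((dualRep K H).toLinearMap ∘ₗ f.evalRightₗ) (rightRep K H).toLinearMap)
        $(r.eq.trans q.antipode.eq.symm))
    simpa only [map_sum, TensorProduct.map_tmul, LinearMap.comp_apply, LinearMap.mul'_apply,
      HopfDual.evalRightₗ_apply, AlgHom.toLinearMap_apply] using h
  rw [hswap]
  simp_rw [dualRep_apply, rightRep_apply, Algebra.TensorProduct.tmul_mul_tmul, one_mul,
    LinearEquiv.symm_apply_apply, ← TensorProduct.tmul_sum]
  congr 1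
  ext v
  let u := ℛ K v
  let s := fun i => ℛ K (q.left i)
  have key : ∀ j, ∑ i ∈ q.index, ∑ k ∈ (s i).index,
      f.ofConv (u.right j * ((s i).right k * antipode K (q.right i))) •
        (u.left j * (s i).left k) = f.ofConv (u.right j) • (u.left j * z) := fun j => by
    have h := congr((TensorProduct.rid K H).toLinearMap
      (TensorProduct.map (LinearMap.mulLeft K (u.left j))
        (f.ofConv ∘ₗ LinearMap.mulLeft K (u.right j)) $(sum_tmul_mul_antipode q s)))
    simpa using h
  simp only [LinearMap.sum_apply, Module.End.mul_apply, LinearMap.mulRight_apply,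
    rightHitHom_apply]
  rw [rightHit_apply _ u, Finset.sum_mul]
  simp_rw [smul_mul_assoc, ← key]
  rw [Finset.sum_comm]
  refine Finset.sum_congr rfl fun i _ => ?_
  have : (antipodeEquiv K H).symm (q.antipode.right i) = q.left i :=
    (antipodeEquiv K H).symm_apply_apply _
  rw [this, rightHit_mul _ u (s i)]
  simp only [HopfDual.evalRight, LinearMap.comp_apply, LinearMap.mulRight_apply, mul_assoc]
  rfl

theorem dualRep_algRep_cross (f : HopfDual K H) {ι : Type*} {x : H} (r : Repr K x ι) :
    ∑ i ∈ r.index, dualRep K H (f.evalRight (r.left i)) * algRep K H (r.right i) =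
      ∑ i ∈ r.index, algRep K H (r.left i) * dualRep K H (f.evalLeft (r.right i)) := by
  let Φl : WithConv (H →ₗ[K] RepTarget K H) :=
    toConv ((dualRep K H).toLinearMap ∘ₗ f.evalLeftₗ)
  let Φr : WithConv (H →ₗ[K] RepTarget K H) :=
    toConv ((dualRep K H).toLinearMap ∘ₗ f.evalRightₗ)
  let α : WithConv (H →ₗ[K] RepTarget K H) := toConv (algRep K H).toLinearMap
  let ρ : WithConv (H →ₗ[K] RepTarget K H) := toConv (rightRep K H).toLinearMap
  let l : WithConv (H →ₗ[K] RepTarget K H) := toConv (leftRep K H).toLinearMap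
  let ρ' : WithConv (H →ₗ[K] RepTarget K H) :=
    toConv (LinearMap.mulRight K (dualRep K H f) ∘ₗ (rightRep K H).toLinearMap)
  let l' : WithConv (H →ₗ[K] RepTarget K H) :=
    toConv (LinearMap.mulLeft K (dualRep K H f) ∘ₗ (leftRep K H).toLinearMap)
  have hα : α = ρ * l := by
    ext y
    rw [(ℛ K y).convMul_apply]
    exact algRep_apply _
  have hρ : Φr * ρ = ρ' := by
    ext y
    rw [(ℛ K y).convMul_apply]
    exact sum_dualRep_mul_rightRep f _
  have hl : l * Φl = l' := by
    ext y
    rw [(ℛ K y).convMul_apply]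
    exact (dualRep_mul_leftRep f _).symm
  have hc : ρ' * l = ρ * l' := by
    ext y
    rw [(ℛ K y).convMul_apply, (ℛ K y).convMul_apply]
    exact Finset.sum_congr rfl fun _ _ => mul_assoc _ _ _
  -- In the convolution algebra the cross relation splits at α = ρ * l: both sides equal x ↦ ∑
  -- ρ(x₍₁₎) f l(x₍₂₎), with f moved leftwards through ρ or rightwards through l.
  have main : Φr * α = α * Φl := by
    rw [hα]
    refine (mul_assoc Φr ρ l).symm.trans ?_
    rw [hρ, hc, ← hl]
    exact (mul_assoc ρ l Φl).symm
  have := congr($main x)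
  rwa [r.convMul_apply, r.convMul_apply] at this

namespace DrinfeldDouble

variable (K H) in
/-- The representation of the Drinfeld double in `H ⊗ End H`. -/
noncomputable def rep : DrinfeldDouble K H →ₐ[K] RepTarget K H :=
  RingQuot.liftAlgHom K ⟨TensorAlgebra.lift K
    ((algRep K H).toLinearMap.coprod (dualRep K H).toLinearMap), by
      intro a b hab
      cases hab with
      | one_left => simp [genL]
      | mul_left x y => simp [genL]
      | one_right => simp [genR]
      | mul_right f g => simp [genR]
      | cross f x r => simpa [genL, genR] using dualRep_algRep_cross f r⟩

theorem rep_ofAlg (x : H) : rep K H (ofAlg K H x) = algRep K H x := by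
  refine (RingQuot.liftAlgHom_mkAlgHom_apply _ _ _ _).trans ?_
  simp

theorem rep_ofDual (f : HopfDual K H) : rep K H (ofDual K H f) = dualRep K H f := by
  refine (RingQuot.liftAlgHom_mkAlgHom_apply _ _ _ _).trans ?_
  simp

theorem ofDual_injective : Function.Injective (ofDual K H) := by
  rw [injective_iff_map_eq_zero]
  intro f hf
  have h := congr(TensorProduct.lid K _ (TensorProduct.map counit LinearMap.id (rep K H $hf)))
  rw [rep_ofDual, dualRep_apply] at h
  simp only [TensorProduct.map_tmul, Bialgebra.counit_one, LinearMap.id_apply,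
    TensorProduct.lid_tmul, one_smul, map_zero] at h
  ext x
  -- The form is recovered from its action by ε(∑ f(x₍₂₎) x₍₁₎) = f(x).
  have h2 := congr(counit (R := K) ($h x))
  rw [rightHitHom_apply, rightHit_apply _ (ℛ K x)] at h2
  have h3 := congr(f.ofConv $(sum_counit_smul (ℛ K x)))
  simp only [map_sum, map_smul, smul_eq_mul, LinearMap.zero_apply, map_zero] at h2 h3
  rw [← h3]
  simpa [mul_comm] using h2

theorem ofAlg_injective : Function.Injective (ofAlg K H) := by
  rw [injective_iff_map_eq_zero]
  intro x hx
  -- Evaluating the End H factor at 1 and then applying ε reduces L_{x₍₃₎} R_{S⁻¹ x₍₁₎} to ε(x₍₃₎)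
  -- ε(x₍₁₎), so the H factor alone returns x.
  let π : RepTarget K H →ₗ[K] H := (TensorProduct.rid K H).toLinearMap ∘ₗ
    TensorProduct.map LinearMap.id (counit ∘ₗ LinearMap.applyₗ (1 : H))
  have hπ : π ∘ₗ (algRep K H).toLinearMap = LinearMap.id := by
    have hr : ∀ (y : H) (w : RepTarget K H),
        π (rightRep K H y * w) = counit (R := K) y • π w := by
      intro y w
      induction w using TensorProduct.induction_on with
      | zero => simp
      | add a b ha hb => rw [mul_add, map_add, ha, hb, map_add, smul_add]
      | tmul a g =>
        rw [rightRep_apply, Algebra.TensorProduct.tmul_mul_tmul]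
        simp [π, counit_antipodeEquiv_symm, smul_smul, mul_comm]
    have hl : ∀ y : H, π (leftRep K H y) = y := by
      intro y
      have h := congr(TensorProduct.rid K H $(sum_tmul_counit_eq (ℛ K y)))
      rw [leftRep_apply (ℛ K y)]
      simpa only [π, map_sum, LinearMap.comp_apply, TensorProduct.map_tmul, LinearMap.id_apply,
        LinearMap.applyₗ_apply_apply, LinearMap.mulLeft_apply, mul_one, LinearEquiv.coe_coe,
        TensorProduct.rid_tmul, one_smul] using h
    ext y
    rw [LinearMap.comp_apply, AlgHom.toLinearMap_apply, algRep_apply (ℛ K y), map_sum]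
    simp_rw [hr, hl]
    exact sum_counit_smul _
  have h := congr(π (rep K H $hx))
  rw [rep_ofAlg, map_zero, map_zero] at h
  exact (LinearMap.congr_fun hπ x).symm.trans h

end DrinfeldDouble

end Faithful

/-! ### Transport of gradings along injective algebra maps. -/

section MainTheorem

open Coalgebra HopfAlgebra WithConv TensorProduct

theorem IsZGrading.map {K D D' : Type*} [Field K] [Ring D] [Algebra K D] [Ring D'] [Algebra K D']
    {A : ℤ → Submodule K D} (hA : IsZGrading ⊤ A) {φ : D →ₐ[K] D'} (hφ : Function.Injective φ) :
    IsZGrading φ.range (fun p => (A p).map φ.toLinearMap) where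
  iSup_eq := by
    rw [← Submodule.map_iSup, hA.iSup_eq]
    ext x
    simp
  indep p := by
    have h := hA.indep p
    rw [Submodule.disjoint_def] at h ⊢
    rintro _ ⟨x, hx, rfl⟩ hx'
    simp only [← Submodule.map_iSup] at hx'
    obtain ⟨y, hy, hyx⟩ := hx'
    obtain rfl := hφ hyx
    rw [h y hx hy, map_zero]
  mul_mem := by
    rintro p q _ ⟨x, hx, rfl⟩ _ ⟨y, hy, rfl⟩
    exact ⟨x * y, hA.mul_mem p q x hx y hy, map_mul φ x y⟩

theorem IsNontrivialGrading.map {K D D' : Type*} [Field K] [Ring D] [Algebra K D] [Ring D']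
    [Algebra K D'] {A : ℤ → Submodule K D} (hA : IsNontrivialGrading A) {φ : D →ₐ[K] D'}
    (hφ : Function.Injective φ) :
    IsNontrivialGrading (fun p => (A p).map φ.toLinearMap) := by
  obtain ⟨p, hp, hAp⟩ := hA
  exact ⟨p, hp, fun h => hAp (Submodule.map_injective_of_injective hφ
    (h.trans (Submodule.map_bot _).symm))⟩

variable {K H ι : Type*} [Field K] [Ring H] [HopfAlgebra K H] [Fintype ι]

theorem isNontrivialGrading_dualPiece {κ : Type*} (a : Module.Basis κ K H) (deg : κ → ℤ)
    (h : ∃ i, deg i ≠ 0) :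
    IsNontrivialGrading (dualPiece a deg) := by
  obtain ⟨i, hi⟩ := h
  refine ⟨deg i, hi, fun h => ?_⟩
  have hmem : (toConv (a.coord i) : HopfDual K H) ∈ dualPiece a deg (deg i) :=
    Submodule.subset_span ⟨i, rfl, rfl⟩
  rw [h, Submodule.mem_bot] at hmem
  have := congr(WithConv.ofConv $hmem (a i))
  simp at this

/-! ### The dual grading of H*. -/

section Dual

variable (a : Module.Basis ι K H)

theorem HopfDual.sum_smul_coord (f : HopfDual K H) :
    ∑ i, f.ofConv (a i) • (toConv (a.coord i) : HopfDual K H) = f := by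
  apply WithConv.ofConv_injective
  refine a.ext fun j => ?_
  classical
  simp

variable (deg : ι → ℤ)

theorem mem_dualPiece_iff {p : ℤ} {f : HopfDual K H} :
    f ∈ dualPiece a deg p ↔ ∀ i, deg i ≠ p → f.ofConv (a i) = 0 := by
  constructor
  · intro hf i hi
    induction hf using Submodule.span_induction with
    | mem f hf =>
      obtain ⟨j, hj, rfl⟩ := hf
      have : j ≠ i := fun h => hi (h ▸ hj)
      simp [Finsupp.single_eq_of_ne this]
    | zero => rfl
    | add f g _ _ hf hg => simp [hf, hg]
    | smul c f _ hf => simp [hf]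
  · intro h
    rw [← HopfDual.sum_smul_coord a f]
    refine Submodule.sum_mem _ fun i _ => ?_
    by_cases hi : deg i = p
    · exact Submodule.smul_mem _ _ (Submodule.subset_span ⟨i, hi, rfl⟩)
    · simp [h i hi]

variable {A : ℤ → Submodule K H} {a deg}

/-- An element of degree `p` is a combination of the basis vectors of degree `p`. -/
theorem coord_eq_zero_of_mem (hA : iSupIndep A) (ha : ∀ i, a i ∈ A (deg i)) {p : ℤ} {x : H}
    (hx : x ∈ A p) {i : ι} (hi : deg i ≠ p) : a.coord i x = 0 := by
  classical
  -- The part z of x in the wrong degrees equals x - y, hence lies in A p as well as in the sum of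
  -- the other pieces; directness kills it.
  let y := ∑ j with deg j = p, a.coord j x • a j
  let z := ∑ j with deg j ≠ p, a.coord j x • a j
  have hyz : y + z = x := by
    rw [Finset.sum_filter_add_sum_filter_not]
    exact a.sum_repr x
  have hy : y ∈ A p := Submodule.sum_mem _ fun j hj =>
    Submodule.smul_mem _ _ ((Finset.mem_filter.mp hj).2 ▸ ha j)
  have hz : z ∈ ⨆ q, ⨆ (_ : q ≠ p), A q := Submodule.sum_mem _ fun j hj =>
    Submodule.smul_mem _ _ (Submodule.mem_iSup_of_mem (deg j)
      (Submodule.mem_iSup_of_mem (Finset.mem_filter.mp hj).2 (ha j)))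
  have hz' : z ∈ A p := by
    rw [← eq_sub_iff_add_eq'] at hyz
    exact hyz ▸ Submodule.sub_mem _ hx hy
  have hz0 : z = 0 := (Submodule.disjoint_def.mp (hA p)) z hz' hz
  have := congr(a.coord i $hz0)
  simpa [z, hi, Finsupp.single_apply] using this

theorem apply_eq_zero_of_mem_dualPiece (hA : iSupIndep A) (ha : ∀ i, a i ∈ A (deg i)) {p q : ℤ}
    (hpq : p ≠ q) {f : HopfDual K H} (hf : f ∈ dualPiece a deg p) {x : H} (hx : x ∈ A q) :
    f.ofConv x = 0 := by
  rw [← a.sum_coord_smul_map]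
  refine Finset.sum_eq_zero fun i _ => ?_
  by_cases hi : deg i = q
  · rw [(mem_dualPiece_iff a deg).mp hf i (hi.trans_ne hpq.symm), smul_zero]
  · rw [coord_eq_zero_of_mem hA ha hx hi, zero_smul]

theorem isZGrading_dualPiece (hA : iSupIndep A) (ha : ∀ i, a i ∈ A (deg i))
    (hΔ : ∀ p : ℤ, ∀ x ∈ A p, comul (R := K) x ∈ ⨆ q : ℤ, tensorPiece (A q) (A (p - q))) :
    IsZGrading (⊤ : Subalgebra K (HopfDual K H)) (dualPiece a deg) where
  iSup_eq := by
    refine eq_top_iff.mpr fun f _ => ?_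
    rw [← HopfDual.sum_smul_coord a f]
    exact Submodule.sum_mem _ fun i _ => Submodule.smul_mem _ _
      (Submodule.mem_iSup_of_mem (deg i) (Submodule.subset_span ⟨i, rfl, rfl⟩))
  indep p := by
    rw [Submodule.disjoint_def]
    intro f hf hf'
    rw [← HopfDual.sum_smul_coord a f]
    refine Finset.sum_eq_zero fun i _ => ?_
    by_cases hi : deg i = p
    · have hle : ⨆ q, ⨆ (_ : q ≠ p), dualPiece a deg q ≤
          LinearMap.ker (LinearMap.applyₗ (a i) ∘ₗ
            (WithConv.linearEquiv K (H →ₗ[K] K)).toLinearMap) :=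
        iSup₂_le fun q hq g hg => (mem_dualPiece_iff a deg).mp hg i (hi.trans_ne hq.symm)
      have : f.ofConv (a i) = 0 := hle hf'
      rw [this, zero_smul]
    · rw [(mem_dualPiece_iff a deg).mp hf i hi, zero_smul]
  mul_mem p q f hf g hg := by
    rw [mem_dualPiece_iff]
    intro i hi
    -- The form f ⊗ g can be nonzero on A r ⊗ A (deg i - r) only if r = p and deg i - r = q, which
    -- deg i ≠ p + q excludes.
    have hle : ⨆ r : ℤ, tensorPiece (A r) (A (deg i - r)) ≤
        LinearMap.ker (LinearMap.mul' K K ∘ₗ TensorProduct.map f.ofConv g.ofConv) := by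
      refine iSup_le fun r => ?_
      rintro _ ⟨t, rfl⟩
      rw [LinearMap.mem_ker]
      induction t using TensorProduct.induction_on with
      | zero => simp
      | add s t hs ht => rw [map_add, map_add, hs, ht, add_zero]
      | tmul x y =>
        simp only [TensorProduct.mapIncl, TensorProduct.map_tmul, Submodule.subtype_apply,
          LinearMap.comp_apply, LinearMap.mul'_apply]
        by_cases hr : p = r
        · rw [apply_eq_zero_of_mem_dualPiece hA ha (by omega) hg y.2, mul_zero]
        · rw [apply_eq_zero_of_mem_dualPiece hA ha hr hf x.2, zero_mul]
    exact hle (hΔ _ _ (ha i))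

theorem exists_deg_ne_zero (hA : iSupIndep A) (hA' : IsNontrivialGrading A)
    (ha : ∀ i, a i ∈ A (deg i)) : ∃ i, deg i ≠ 0 := by
  obtain ⟨p, hp, hAp⟩ := hA'
  by_contra! h
  refine hAp ((Submodule.eq_bot_iff _).mpr fun x hx => ?_)
  rw [← a.sum_repr x]
  refine Finset.sum_eq_zero fun i _ => ?_
  have := coord_eq_zero_of_mem hA ha hx ((h i).trans_ne hp.symm)
  rw [Module.Basis.coord_apply] at this
  rw [this, zero_smul]

end Dual

/-! ### The canonical element: basis independence, Yang–Baxter equation, degrees. -/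

namespace DrinfeldDouble

variable (a : Module.Basis ι K H)

theorem ofDual_cross (f : HopfDual K H) {x : H} (r : Repr K x (H × H)) :
    ∑ i ∈ r.index, ofDual K H (f.evalRight (r.left i)) * ofAlg K H (r.right i) =
      ∑ i ∈ r.index, ofAlg K H (r.left i) * ofDual K H (f.evalLeft (r.right i)) := by
  have := proj_eq (Rel.cross f x r)
  simp only [map_sum, map_mul] at this
  exact this

/-- Both sides are the tensor of φ under H ⊗ H* ≅ End H. Taking φ = id gives basis independence;
taking φ a multiplication moves a factor from H to a translate of the dual form. -/
theorem sum_map_tmul_coord {κ : Type*} [Fintype κ] (c : Module.Basis κ K H) (φ : H →ₗ[K] H) :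
    ∑ i, φ (c i) ⊗ₜ[K] (toConv (c.coord i) : HopfDual K H) =
      ∑ j, a j ⊗ₜ[K] (toConv (a.coord j ∘ₗ φ) : HopfDual K H) := by
  have hφ : ∀ i, φ (c i) = ∑ j, a.coord j (φ (c i)) • a j := fun i =>
    (a.sum_repr (φ (c i))).symm
  conv_lhs => enter [2, i]; rw [hφ i, TensorProduct.sum_tmul]
  rw [Finset.sum_comm]
  refine Finset.sum_congr rfl fun j _ => ?_
  simp_rw [TensorProduct.smul_tmul, ← TensorProduct.tmul_sum]
  congr 1
  exact HopfDual.sum_smul_coord c (toConv (a.coord j ∘ₗ φ))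

theorem canonicalR_eq {κ : Type*} [Fintype κ] (c : Module.Basis κ K H) :
    canonicalR c = canonicalR a := by
  have h := congr(TensorProduct.map (ofAlg K H).toLinearMap (ofDual K H).toLinearMap
    $(sum_map_tmul_coord a c LinearMap.id))
  simp only [map_sum, TensorProduct.map_tmul, LinearMap.id_apply, LinearMap.comp_id] at h
  exact h

theorem sum_ofAlg_map_tmul (φ : H →ₗ[K] H) :
    ∑ i, ofAlg K H (φ (a i)) ⊗ₜ[K] ofDual K H (toConv (a.coord i)) =
      ∑ i, ofAlg K H (a i) ⊗ₜ[K] ofDual K H (toConv (a.coord i ∘ₗ φ)) := by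
  have h := congr(TensorProduct.map (ofAlg K H).toLinearMap (ofDual K H).toLinearMap
    $(sum_map_tmul_coord a a φ))
  simp only [map_sum, TensorProduct.map_tmul] at h
  exact h

/-- Transposition of Δ into the product of H*. The free map F allows both Δ and, after a flip, Δᵒᵖ.
-/
theorem sum_mul_coord {N : Type*} [AddCommGroup N] [Module K N] (F : H ⊗[K] H →ₗ[K] N) :
    ∑ j, ∑ k, F (a j ⊗ₜ a k) ⊗ₜ[K] (toConv (a.coord j) * toConv (a.coord k) : HopfDual K H) =
      ∑ m, F (comul (a m)) ⊗ₜ[K] (toConv (a.coord m) : HopfDual K H) := by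
  have hF : ∑ j, ∑ k, (LinearMap.mul' K K ∘ₗ
      TensorProduct.map (a.coord j) (a.coord k)).smulRight (F (a j ⊗ₜ a k)) = F := by
    ext x y
    have h : ∀ z, F (z ⊗ₜ y) = ∑ k, a.coord k y • F (z ⊗ₜ a k) := fun z =>
      (a.sum_coord_smul_map (F ∘ₗ TensorProduct.mk K H H z) y).symm
    have h' := a.sum_coord_smul_map (F ∘ₗ (TensorProduct.mk K H H).flip y) x
    simp only [LinearMap.comp_apply, LinearMap.flip_apply, TensorProduct.mk_apply, h] at h'
    simp only [TensorProduct.AlgebraTensorModule.curry_apply, LinearMap.restrictScalars_self,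
      TensorProduct.curry_apply, LinearMap.sum_apply, LinearMap.smulRight_apply,
      LinearMap.comp_apply, TensorProduct.map_tmul, LinearMap.mul'_apply, mul_smul]
    rw [h, ← h']
    simp_rw [Finset.smul_sum]
  have hm : ∀ m, F (comul (a m)) = ∑ j, ∑ k,
      ((toConv (a.coord j) * toConv (a.coord k) : HopfDual K H).ofConv (a m)) •
        F (a j ⊗ₜ a k) := fun m => by
    conv_lhs => rw [← hF]
    simp only [LinearMap.sum_apply]
    rfl
  simp_rw [hm, TensorProduct.sum_tmul, TensorProduct.smul_tmul]
  conv_rhs => rw [Finset.sum_comm]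
  refine Finset.sum_congr rfl fun j _ => ?_
  conv_rhs => rw [Finset.sum_comm]
  refine Finset.sum_congr rfl fun k _ => ?_
  rw [← TensorProduct.tmul_sum, HopfDual.sum_smul_coord]

/-- The canonical element intertwines the coproduct of `H` with the opposite coproduct. -/
theorem canonicalR_mul_comul (x : H) :
    canonicalR a * TensorProduct.map (ofAlg K H).toLinearMap (ofAlg K H).toLinearMap (comul x) =
      TensorProduct.map (ofAlg K H).toLinearMap (ofAlg K H).toLinearMap
        (TensorProduct.comm K H H (comul x)) * canonicalR a := by
  let r := ℛ K x
  -- Moving y and z across the dual bases (`hl`, `hr`) leaves aᵢ alone in the first leg; the second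
  -- legs are then the two sides of the cross relation for aᵢ*.
  have hl : ∀ y z : H, canonicalR a * (ofAlg K H y ⊗ₜ[K] ofAlg K H z) =
      ∑ i, ofAlg K H (a i) ⊗ₜ[K]
        (ofDual K H (HopfDual.evalRight (toConv (a.coord i)) y) * ofAlg K H z) := fun y z => by
    have h := congr($(sum_ofAlg_map_tmul a (LinearMap.mulRight K y)) * (1 ⊗ₜ[K] ofAlg K H z))
    simp only [Finset.sum_mul, Algebra.TensorProduct.tmul_mul_tmul, mul_one,
      LinearMap.mulRight_apply, map_mul] at h
    simp only [canonicalR, Finset.sum_mul, Algebra.TensorProduct.tmul_mul_tmul]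
    exact h
  have hr : ∀ y z : H, (ofAlg K H z ⊗ₜ[K] ofAlg K H y) * canonicalR a =
      ∑ i, ofAlg K H (a i) ⊗ₜ[K]
        (ofAlg K H y * ofDual K H (HopfDual.evalLeft (toConv (a.coord i)) z)) := fun y z => by
    have h := congr((1 ⊗ₜ[K] ofAlg K H y) * $(sum_ofAlg_map_tmul a (LinearMap.mulLeft K z)))
    simp only [Finset.mul_sum, Algebra.TensorProduct.tmul_mul_tmul, one_mul,
      LinearMap.mulLeft_apply, map_mul] at h
    simp only [canonicalR, Finset.mul_sum, Algebra.TensorProduct.tmul_mul_tmul]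
    exact h
  rw [← r.eq]
  simp only [map_sum, TensorProduct.map_tmul, TensorProduct.comm_tmul, AlgHom.toLinearMap_apply]
  rw [Finset.mul_sum, Finset.sum_mul]
  simp_rw [hl, hr]
  rw [Finset.sum_comm]
  conv_rhs => rw [Finset.sum_comm]
  refine Finset.sum_congr rfl fun i _ => ?_
  rw [← TensorProduct.tmul_sum, ← TensorProduct.tmul_sum, ofDual_cross]

theorem leg13_mul_leg23_canonicalR :
    leg13 K (DrinfeldDouble K H) (canonicalR a) * leg23 K (DrinfeldDouble K H) (canonicalR a) =
      ∑ m, TensorProduct.map (ofAlg K H).toLinearMap (ofAlg K H).toLinearMap (comul (a m)) ⊗ₜ[K]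
        ofDual K H (toConv (a.coord m)) := by
  have h := congr(LinearMap.lTensor (DrinfeldDouble K H ⊗[K] DrinfeldDouble K H)
    (ofDual K H).toLinearMap $(sum_mul_coord a
      (TensorProduct.map (ofAlg K H).toLinearMap (ofAlg K H).toLinearMap)))
  simp only [map_sum, LinearMap.lTensor_tmul, TensorProduct.map_tmul,
    AlgHom.toLinearMap_apply, map_mul] at h
  rw [← h]
  simp only [leg13, leg23, canonicalR, map_sum, Algebra.TensorProduct.map_tmul,
    Finset.sum_mul_sum, Algebra.TensorProduct.includeLeft_apply,
    Algebra.TensorProduct.includeRight_apply, Algebra.TensorProduct.tmul_mul_tmul, mul_one,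
    one_mul, AlgHom.id_apply]

theorem leg23_mul_leg13_canonicalR :
    leg23 K (DrinfeldDouble K H) (canonicalR a) * leg13 K (DrinfeldDouble K H) (canonicalR a) =
      ∑ m, TensorProduct.map (ofAlg K H).toLinearMap (ofAlg K H).toLinearMap
        (TensorProduct.comm K H H (comul (a m))) ⊗ₜ[K] ofDual K H (toConv (a.coord m)) := by
  have h := congr(LinearMap.lTensor (DrinfeldDouble K H ⊗[K] DrinfeldDouble K H)
    (ofDual K H).toLinearMap $(sum_mul_coord a
      (TensorProduct.map (ofAlg K H).toLinearMap (ofAlg K H).toLinearMap ∘ₗ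
        (TensorProduct.comm K H H).toLinearMap)))
  simp only [map_sum, LinearMap.lTensor_tmul, TensorProduct.map_tmul, LinearMap.comp_apply,
    LinearEquiv.coe_coe, TensorProduct.comm_tmul, AlgHom.toLinearMap_apply, map_mul] at h
  rw [← h]
  simp only [leg13, leg23, canonicalR, map_sum, Algebra.TensorProduct.map_tmul,
    Finset.sum_mul_sum, Algebra.TensorProduct.includeLeft_apply,
    Algebra.TensorProduct.includeRight_apply, Algebra.TensorProduct.tmul_mul_tmul, mul_one,
    one_mul, AlgHom.id_apply]

theorem isYangBaxter_canonicalR : IsYangBaxter (canonicalR a) := by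
  rw [IsYangBaxter, mul_assoc, leg13_mul_leg23_canonicalR, leg23_mul_leg13_canonicalR,
    Finset.mul_sum, Finset.sum_mul]
  refine Finset.sum_congr rfl fun m _ => ?_
  simp only [leg12, Algebra.TensorProduct.includeLeft_apply,
    Algebra.TensorProduct.tmul_mul_tmul, one_mul, mul_one]
  rw [canonicalR_mul_comul]

theorem canonicalR_mem {A : ℤ → Submodule K H} {deg : ι → ℤ} (ha : ∀ i, a i ∈ A (deg i)) :
    canonicalR a ∈ ⨆ p, tensorPiece ((A p).map (ofAlg K H).toLinearMap)
      ((dualPiece a deg p).map (ofDual K H).toLinearMap) := by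
  refine Submodule.sum_mem _ fun i _ => Submodule.mem_iSup_of_mem (deg i) ?_
  exact ⟨⟨_, Submodule.mem_map_of_mem (ha i)⟩ ⊗ₜ
    ⟨_, Submodule.mem_map_of_mem (Submodule.subset_span ⟨i, rfl, rfl⟩)⟩, rfl⟩

theorem canonicalR_notMem {A : ℤ → Submodule K H} {deg : ι → ℤ} (hA : iSupIndep A)
    (ha : ∀ i, a i ∈ A (deg i)) {p : ℤ} (hp : ∃ i, deg i ≠ p) (B : Submodule K (HopfDual K H))
    (hl : Function.Injective (ofAlg K H)) (hr : Function.Injective (ofDual K H)) :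
    canonicalR a ∉ tensorPiece ((A p).map (ofAlg K H).toLinearMap)
      (B.map (ofDual K H).toLinearMap) := by
  obtain ⟨i, hi⟩ := hp
  obtain ⟨ψ, hψ⟩ := LinearMap.exists_leftInverse_of_injective (ofAlg K H).toLinearMap
    (LinearMap.ker_eq_bot.mpr hl)
  obtain ⟨χ, hχ⟩ := LinearMap.exists_leftInverse_of_injective (ofDual K H).toLinearMap
    (LinearMap.ker_eq_bot.mpr hr)
  replace hψ : ∀ x, ψ (ofAlg K H x) = x := LinearMap.congr_fun hψ
  replace hχ : ∀ x, χ (ofDual K H x) = x := LinearMap.congr_fun hχ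
  -- Pairing with aᵢ* ⊗ (evaluation at aᵢ), for some i with deg i ≠ p, gives 1 on R but kills A p ⊗
  -- B, since aᵢ* vanishes on A p.
  let F := TensorProduct.map (a.coord i ∘ₗ ψ) (LinearMap.applyₗ (a i) ∘ₗ
    (WithConv.linearEquiv K (H →ₗ[K] K)).toLinearMap ∘ₗ χ)
  have h1 : TensorProduct.lid K K (F (canonicalR a)) = 1 := by
    classical
    simp [F, canonicalR, hψ, hχ, Finsupp.single_apply]
  rintro ⟨t, ht⟩
  have h0 : F (canonicalR a) = 0 := by
    rw [← ht]
    clear ht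
    induction t using TensorProduct.induction_on with
    | zero => simp
    | add s t hs ht => rw [map_add, map_add, hs, ht, add_zero]
    | tmul x y =>
      obtain ⟨_, x, hx, rfl⟩ := x
      have : a.coord i (ψ (ofAlg K H x)) = 0 := by
        rw [hψ, coord_eq_zero_of_mem hA ha hx hi]
      simp only [F, TensorProduct.mapIncl, TensorProduct.map_tmul, Submodule.subtype_apply,
        LinearMap.comp_apply, AlgHom.toLinearMap_apply]
      rw [this, TensorProduct.zero_tmul]
  rw [h0, map_zero] at h1
  exact zero_ne_one h1

end DrinfeldDouble

end MainTheorem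

theorem proposition2p2 {K H : Type*} [Field K] [Ring H] [HopfAlgebra K H] [FiniteDimensional K H]
    (A : ℤ → Submodule K H)
    (hA : IsZGrading (⊤ : Subalgebra K H) A)
    (hA_nontrivial : IsNontrivialGrading A)
    (hA_comul : ∀ p : ℤ, ∀ x ∈ A p,
      Coalgebra.comul (R := K) x ∈ ⨆ q : ℤ, tensorPiece (A q) (A (p - q))) :
    -- `H` and `H*` are identified with subalgebras of `D(H)`
    Function.Injective (DrinfeldDouble.ofAlg K H) ∧
    Function.Injective (DrinfeldDouble.ofDual K H) ∧
    -- for every basis `a` of `H` that is a union of bases of the pieces `A p`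
    ∀ {ι : Type*} [Fintype ι] (a : Module.Basis ι K H) (deg : ι → ℤ), (∀ i, a i ∈ A (deg i)) →
      IsBaxterizable (DrinfeldDouble.ofAlg K H).range (DrinfeldDouble.ofDual K H).range
        (fun p => (A p).map (DrinfeldDouble.ofAlg K H).toLinearMap)
        (fun p => (dualPiece a deg p).map (DrinfeldDouble.ofDual K H).toLinearMap)
        (DrinfeldDouble.canonicalR a) ∧
      IsNontrivialGrading (fun p => (A p).map (DrinfeldDouble.ofAlg K H).toLinearMap) ∧
      IsNontrivialGrading
        (fun p => (dualPiece a deg p).map (DrinfeldDouble.ofDual K H).toLinearMap) ∧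
      -- `R` is not concentrated in degree zero
      DrinfeldDouble.canonicalR a ∉
        tensorPiece ((A 0).map (DrinfeldDouble.ofAlg K H).toLinearMap)
          ((dualPiece a deg 0).map (DrinfeldDouble.ofDual K H).toLinearMap) ∧
      -- `R` does not depend on the basis
      ∀ {κ : Type*} [Fintype κ] (c : Module.Basis κ K H),
        DrinfeldDouble.canonicalR c = DrinfeldDouble.canonicalR a := by
  have hl : Function.Injective (DrinfeldDouble.ofAlg K H) := DrinfeldDouble.ofAlg_injective
  have hr : Function.Injective (DrinfeldDouble.ofDual K H) := DrinfeldDouble.ofDual_injective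
  refine ⟨hl, hr, fun {ι} _ a deg ha => ?_⟩
  have hdeg := exists_deg_ne_zero hA.indep hA_nontrivial ha
  exact ⟨⟨hA.map hl, (isZGrading_dualPiece hA.indep ha hA_comul).map hr,
    DrinfeldDouble.isYangBaxter_canonicalR a, DrinfeldDouble.canonicalR_mem a ha⟩,
    hA_nontrivial.map hl, (isNontrivialGrading_dualPiece a deg hdeg).map hr,
    DrinfeldDouble.canonicalR_notMem a hA.indep ha hdeg _ hl hr,
    fun c => DrinfeldDouble.canonicalR_eq a c⟩
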